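/- Let $n\ge 2$, let $a,b,c_1,\dots,c_n\in\mathbb{C}$, and put $\alpha=e^{2\pi\sqrt{-1}\,a}$, $\beta=e^{2\pi\sqrt{-1}\,b}$, $\gamma_k=e^{2\pi\sqrt{-1}\,c_k}$. Identify $\mathbb{C}^{2^n}$ with $(\mathbb{C}^2)^{\otimes n}$, with standard basis indexed by $I=(i_1,\dots,i_n)\in\{0,1\}^n$, and write $|I|=i_1+\dots+i_n$. For $k=1,\dots,n$ let $$M_k=E_2\otimes\cdots\otimes E_2\otimes G_k\otimes E_2\otimes\cdots\otimes E_2\quad(G_k\text{ in the }k\text{-th place}),\qquad G_k=\begin{pmatrix}1&-\gamma_k^{-1}\\0&\gamma_k^{-1}\end{pmatrix},$$ and let $M_0=E_{2^n}-N_0$, where the row of $N_0$ with index $(1,\dots,1)$ is the vector $v$ and all other rows of $N_0$ are zero, with $$v_{(0,\dots,0)}=(-1)^n\frac{(\alpha-1)(\beta-1)\prod_{k}\gamma_k}{\alpha\beta},\qquad v_I=(-1)^{n+|I|}\frac{\bigl(\alpha\beta+(-1)^{|I|}\prod_{k}\gamma_k^{i_k}\bigr)\prod_{k}\gamma_k^{1-i_k}}{\alpha\beta}\quad(I\ne(0,\dots,0)).$$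 Let $\mathrm{Mon}\subset GL_{2^n}(\mathbb{C})$ be the group generated by $M_0,M_1,\dots,M_n$ (the monodromy group of Lauricella's hypergeometric function $F_C(a,b,c_1,\dots,c_n;x)$), let $\mathrm{Ref}\subset\mathrm{Mon}$ be the subgroup generated by the elements $gM_0g^{-1}$ $(g\in\mathrm{Mon})$, and let $\mathrm{Ref}^0$ be the connected component of the identity of $\mathrm{Ref}$ in the Zariski topology. Assume that $\mathrm{Ref}$ acts irreducibly on $\mathbb{C}^{2^n}$ and that $\mathrm{Ref}^0$ acts reducibly on $\mathbb{C}^{2^n}$. Then $\mathrm{Ref}$ is finite, and $\mathrm{Mon}$ is finite. -/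

import Mathlib

noncomputable section

namespace LauricellaFC

/-! ### The Zariski topology on `GL` and the identity component of a subgroup -/

section Zariski

variable {ι : Type*} [Fintype ι] [DecidableEq ι]

/-- The common zero set in `GL` of a set of polynomials in the matrix entries. -/
def zeroSet (P : Set (MvPolynomial (ι × ι) ℂ)) : Set (Matrix.GeneralLinearGroup ι ℂ) :=
  {g | ∀ p ∈ P, MvPolynomial.eval (fun ij : ι × ι => (g : Matrix ι ι ℂ) ij.1 ij.2) p = 0}

/-- The Zariski topology on `GL`: the closed sets are the zero sets of polynomials in the matrix
entries. (Allowing also the inverse of the determinant gives the same closed sets.) -/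
@[reducible]
def zariskiTopology (ι : Type*) [Fintype ι] [DecidableEq ι] : TopologicalSpace (Matrix.GeneralLinearGroup ι ℂ) :=
  TopologicalSpace.ofClosed {S | ∃ P : Set (MvPolynomial (ι × ι) ℂ), S = zeroSet P}
    ⟨{1}, by ext g; simp [zeroSet]⟩
    (by
      intro A hA
      refine ⟨{p | ∃ P : Set (MvPolynomial (ι × ι) ℂ), zeroSet P ∈ A ∧ p ∈ P}, ?_⟩
      ext g
      constructor
      · rintro hg p ⟨P, hP, hp⟩
        exact hg _ hP p hp
      · intro hg S hS
        obtain ⟨P, rfl⟩ := hA hS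
        exact fun p hp => hg p ⟨P, hS, hp⟩)
    (by
      rintro _ ⟨P, rfl⟩ _ ⟨Q, rfl⟩
      refine ⟨{r | ∃ p ∈ P, ∃ q ∈ Q, r = p * q}, ?_⟩
      ext g
      constructor
      · rintro (hg | hg) r ⟨p, hp, q, hq, rfl⟩
        · rw [map_mul, hg p hp, zero_mul]
        · rw [map_mul, hg q hq, mul_zero]
      · intro hg
        by_contra hcon
        simp only [Set.mem_union, not_or] at hcon
        obtain ⟨h1, h2⟩ := hcon
        simp only [zeroSet, Set.mem_ofPred_eq, not_forall] at h1 h2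
        obtain ⟨p, hp, hp0⟩ := h1
        obtain ⟨q, hq, hq0⟩ := h2
        have := hg (p * q) ⟨p, hp, q, hq, rfl⟩
        rw [map_mul] at this
        exact (mul_ne_zero hp0 hq0) this)

theorem isClosed_zariski_iff (S : Set (Matrix.GeneralLinearGroup ι ℂ)) :
    @IsClosed _ (zariskiTopology ι) S ↔ ∃ P : Set (MvPolynomial (ι × ι) ℂ), S = zeroSet P := by
  rw [← @isOpen_compl_iff _ _ (zariskiTopology ι)]
  change Sᶜᶜ ∈ {S | ∃ P : Set (MvPolynomial (ι × ι) ℂ), S = zeroSet P} ↔ _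
  rw [compl_compl]
  rfl

theorem continuous_mul_left_zariski (g : Matrix.GeneralLinearGroup ι ℂ) :
    @Continuous _ _ (zariskiTopology ι) (zariskiTopology ι) (fun x => g * x) := by
  let _ := zariskiTopology ι
  rw [continuous_iff_isClosed]
  intro S hS
  obtain ⟨P, rfl⟩ := (isClosed_zariski_iff S).1 hS
  rw [isClosed_zariski_iff]
  refine ⟨(fun p => MvPolynomial.bind₁ (fun ij : ι × ι =>
    ∑ k, MvPolynomial.C ((g : Matrix ι ι ℂ) ij.1 k) * MvPolynomial.X (k, ij.2)) p) '' P, ?_⟩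
  ext x
  have key : ∀ p : MvPolynomial (ι × ι) ℂ,
      MvPolynomial.eval (fun ij : ι × ι => (x : Matrix ι ι ℂ) ij.1 ij.2)
        (MvPolynomial.bind₁ (fun ij : ι × ι =>
          ∑ k, MvPolynomial.C ((g : Matrix ι ι ℂ) ij.1 k) * MvPolynomial.X (k, ij.2)) p) =
      MvPolynomial.eval (fun ij : ι × ι =>
        ((g * x : Matrix.GeneralLinearGroup ι ℂ) : Matrix ι ι ℂ) ij.1 ij.2) p := by
    intro p
    rw [← MvPolynomial.coe_aeval_eq_eval, ← MvPolynomial.coe_aeval_eq_eval]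
    simp only [RingHom.coe_coe]
    rw [MvPolynomial.aeval_bind₁]
    simp [Matrix.mul_apply]
  constructor
  · rintro hx _ ⟨p, hp, rfl⟩
    exact (key p).trans (hx p hp)
  · intro hx p hp
    exact (key p).symm.trans (hx _ ⟨p, hp, rfl⟩)

/-- For a subgroup `G` of `GL`, the connected component of the identity of `G` with respect to
(the subspace topology induced by) the Zariski topology. -/
def identityComponent (G : Subgroup (Matrix.GeneralLinearGroup ι ℂ)) :
    Subgroup (Matrix.GeneralLinearGroup ι ℂ) :=
  have key : ∀ x ∈ @connectedComponentIn _ (zariskiTopology ι) (G : Set _) 1,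
      ∀ y ∈ @connectedComponentIn _ (zariskiTopology ι) (G : Set _) 1,
        x⁻¹ * y ∈ @connectedComponentIn _ (zariskiTopology ι) (G : Set _) 1 := by
    let _ := zariskiTopology ι
    intro x hx y hy
    have hsub := connectedComponentIn_subset (G : Set (Matrix.GeneralLinearGroup ι ℂ)) 1
    have hpre : IsPreconnected ((fun z => x⁻¹ * z) ''
        connectedComponentIn (G : Set (Matrix.GeneralLinearGroup ι ℂ)) 1) :=
      isPreconnected_connectedComponentIn.image _
        (continuous_mul_left_zariski x⁻¹).continuousOn
    refine hpre.subset_connectedComponentIn ⟨x, hx, inv_mul_cancel x⟩ ?_ ⟨y, hy, rfl⟩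
    rintro _ ⟨z, hz, rfl⟩
    exact G.mul_mem (G.inv_mem (hsub hx)) (hsub hz)
  have one : (1 : Matrix.GeneralLinearGroup ι ℂ) ∈
      @connectedComponentIn _ (zariskiTopology ι) (G : Set _) 1 :=
    @mem_connectedComponentIn _ (zariskiTopology ι) _ _ G.one_mem
  have inv : ∀ x ∈ @connectedComponentIn _ (zariskiTopology ι) (G : Set _) 1,
      x⁻¹ ∈ @connectedComponentIn _ (zariskiTopology ι) (G : Set _) 1 := fun x hx => by
    simpa using key x hx 1 one
  { carrier := @connectedComponentIn _ (zariskiTopology ι) (G : Set _) 1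
    one_mem' := one
    inv_mem' := fun {x} hx => inv x hx
    mul_mem' := fun {x y} hx hy => by simpa using key x⁻¹ (inv x hx) y hy }

/-- The action of a subgroup of `GL` on column vectors. -/
def standardRep (G : Subgroup (Matrix.GeneralLinearGroup ι ℂ)) :
    Representation ℂ G (ι → ℂ) :=
  (Units.coeHom (Module.End ℂ (ι → ℂ))).comp
    (Matrix.GeneralLinearGroup.toLin.toMonoidHom.comp G.subtype)

theorem standardRep_apply (G : Subgroup (Matrix.GeneralLinearGroup ι ℂ)) (g : G) (w : ι → ℂ) :
    standardRep G g w = Matrix.mulVec ((g : Matrix.GeneralLinearGroup ι ℂ) : Matrix ι ι ℂ) w :=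
  rfl

/-- `G` acts irreducibly on column vectors. -/
def ActsIrreducibly (G : Subgroup (Matrix.GeneralLinearGroup ι ℂ)) : Prop :=
  (standardRep G).IsIrreducible

end Zariski

/-! ### The monodromy matrices -/

/-- The index set `{0,1}ⁿ`, so that `Idx n → ℂ` is `(ℂ²)^{⊗ n}` with its standard basis. -/
abbrev Idx (n : ℕ) : Type := Fin n → Fin 2

/-- The tensor (Kronecker) product `A₁ ⊗ ⋯ ⊗ Aₙ` of `2 × 2` matrices. -/
def tensor {n : ℕ} (A : Fin n → Matrix (Fin 2) (Fin 2) ℂ) : Matrix (Idx n) (Idx n) ℂ :=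
  Matrix.of fun I J => ∏ k, A k (I k) (J k)

/-- `exp (2 π √-1 z)`. -/
def expTwoPiI (z : ℂ) : ℂ := Complex.exp (2 * Real.pi * Complex.I * z)

/-- The matrix `G_k`, as a function of `γ = γ_k`. -/
def matG (γ : ℂ) : Matrix (Fin 2) (Fin 2) ℂ := !![1, -γ⁻¹; 0, γ⁻¹]

/-- `M_k = E₂ ⊗ ⋯ ⊗ G_k ⊗ ⋯ ⊗ E₂`, with `G_k` in the `k`-th place. -/
def matM {n : ℕ} (c : Fin n → ℂ) (k : Fin n) : Matrix (Idx n) (Idx n) ℂ :=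
  tensor (Function.update (fun _ => 1) k (matG (expTwoPiI (c k))))

/-- The vector `v`; here `α = exp (2πia)`, `β = exp (2πib)`, `γ_k = exp (2πic_k)`. -/
def vecV {n : ℕ} (a b : ℂ) (c : Fin n → ℂ) (I : Idx n) : ℂ :=
  let α := expTwoPiI a
  let β := expTwoPiI b
  let γ := fun k => expTwoPiI (c k)
  let s : ℕ := ∑ k, (I k : ℕ)
  if I = 0 then
    (-1) ^ n * ((α - 1) * (β - 1) * ∏ k, γ k) / (α * β)
  else
    (-1) ^ (n + s) * ((α * β + (-1) ^ s * ∏ k, γ k ^ (I k : ℕ)) * ∏ k, γ k ^ (1 - (I k : ℕ)))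
      / (α * β)

/-- `N₀`: its row of index `(1,…,1)` is `v`, all other rows are zero. -/
def matN₀ {n : ℕ} (a b : ℂ) (c : Fin n → ℂ) : Matrix (Idx n) (Idx n) ℂ :=
  Matrix.updateRow 0 1 (vecV a b c)

/-- `M₀ = E - N₀`. -/
def matM₀ {n : ℕ} (a b : ℂ) (c : Fin n → ℂ) : Matrix (Idx n) (Idx n) ℂ :=
  1 - matN₀ a b c

theorem expTwoPiI_ne_zero (z : ℂ) : expTwoPiI z ≠ 0 := Complex.exp_ne_zero _

theorem tensor_mul {n : ℕ} (A B : Fin n → Matrix (Fin 2) (Fin 2) ℂ) :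
    tensor A * tensor B = tensor (fun k => A k * B k) := by
  ext I J
  simp only [tensor, Matrix.mul_apply, Matrix.of_apply, ← Finset.prod_mul_distrib]
  rw [Finset.prod_univ_sum]
  simp

theorem tensor_one {n : ℕ} : tensor (fun _ : Fin n => 1) = 1 := by
  ext I J
  simp only [tensor, Matrix.of_apply, Matrix.one_apply, funext_iff]
  rw [Finset.prod_ite_zero]
  simp

/-- The matrices `M_k` are invertible. -/
theorem isUnit_matM {n : ℕ} (c : Fin n → ℂ) (k : Fin n) : IsUnit (matM c k) := by
  have h := expTwoPiI_ne_zero (c k)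
  refine IsUnit.of_mul_eq_one (tensor
    (Function.update (fun _ => 1) k !![1, 1; 0, expTwoPiI (c k)])) ?_
  rw [matM, tensor_mul, ← tensor_one]
  congr 1
  funext j
  by_cases hj : j = k
  · subst hj
    ext x y
    fin_cases x <;> fin_cases y <;> simp [matG, Matrix.mul_apply, h]
  · simp [hj]

/-- The matrix `M₀` is invertible, with determinant `δ₀`. -/
theorem det_matM₀ {n : ℕ} (hn : 0 < n) (a b : ℂ) (c : Fin n → ℂ) :
    (matM₀ a b c).det =
      (-1) ^ (n + 1) * (∏ k, expTwoPiI (c k)) / (expTwoPiI a * expTwoPiI b) := by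
  have ha := expTwoPiI_ne_zero a
  have hb := expTwoPiI_ne_zero b
  have hne : (1 : Idx n) ≠ 0 := fun h => by simpa using congrFun h ⟨0, hn⟩
  have h1 : matM₀ a b c = 1 + Matrix.replicateCol Unit (Pi.single 1 1 : Idx n → ℂ) *
      Matrix.replicateRow Unit (-vecV a b c) := by
    ext I J
    by_cases hI : I = 1
    · subst hI
      simp [matM₀, matN₀, Matrix.mul_apply, sub_eq_add_neg]
    · simp [matM₀, matN₀, hI, Matrix.mul_apply]
  rw [h1, Matrix.det_one_add_replicateCol_mul_replicateRow]
  simp [vecV, hne]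
  field_simp
  ring

/-! ### The monodromy group and its reflection subgroup -/

/-- The monodromy group, generated by `M₀, M₁, …, Mₙ` (which are invertible for `n ≥ 1` by
`det_matM₀` and `isUnit_matM`). -/
def Mon {n : ℕ} (a b : ℂ) (c : Fin n → ℂ) : Subgroup (Matrix.GeneralLinearGroup (Idx n) ℂ) :=
  Subgroup.closure
    {g | (g : Matrix (Idx n) (Idx n) ℂ) = matM₀ a b c ∨
      ∃ k, (g : Matrix (Idx n) (Idx n) ℂ) = matM c k}

/-- The reflection subgroup, generated by the conjugates `g M₀ g⁻¹` with `g` in `Mon`. -/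
def Ref {n : ℕ} (a b : ℂ) (c : Fin n → ℂ) : Subgroup (Matrix.GeneralLinearGroup (Idx n) ℂ) :=
  Subgroup.closure
    {x | ∃ g ∈ Mon a b c, ∃ r : Matrix.GeneralLinearGroup (Idx n) ℂ,
      (r : Matrix (Idx n) (Idx n) ℂ) = matM₀ a b c ∧ x = g * r * g⁻¹}

end LauricellaFC

end

/-!
Write `V = ℂ^(2ⁿ)` and let `H` be the identity component of the reflection subgroup `Ref`. In the
Zariski topology, which is Noetherian, `H` has finite index in `Ref`
(`finiteIndex_identityComponent`), and it is normalized by `Mon`.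

**Clifford theory with reflections** (`scalar_or_monomial`). Let `W` be a minimal `H`-invariant
subspace. If `dim W ≥ 2`, a reflection `r` of `Ref` fixes a nonzero vector of `W`, so `W` and `r W`
meet and hence agree; then `W` is invariant under `Ref` and is all of `V`, so `H` is irreducible.
Hence `H` has a common eigenvector, the weight spaces of `H` span `V`, and `Mon` permutes them. By
the same argument a weight space of dimension at least two is preserved by all reflections and is
all of `V`. So either `H` consists of scalars, or `Mon` permutes the lines of a basis of `V`.

**The monomial case does not occur** (`not_monomial`). Let `u` be the root and `v` the covector of
`M₀`, so that `M₀ x = x - v(x) u`. For a nonempty proper subset `I` of the indices, the value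
`v(∏_{k ∈ I} M_k u)` equals `∏_{k ∈ I} (1 + γ_k⁻¹)`; it vanishes if some `γ_k` is `-1`
(`vecV_dotProduct_matProd`). If all `γ_k` are `-1`, the span of `u` and `M₁ ⋯ Mₙ u` is therefore
invariant under `Ref` (`exists_gamma_ne_neg_one`), against irreducibility. Otherwise, `M_k`
preserves all lines unless `γ_k = -1`, and `M₀` exchanges two lines, whose sum `P` contains `u`.
Modulo elements preserving all lines, every element of the group generated by `M₁, …, Mₙ` is
a product of the involutions `M_k` over a proper subset `I` of the indices. If it moves `P`,
then `v(∏_{k ∈ I} M_k u) = 0` implies that the image of `P` is spanned by two lines fixed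
pointwise by `M₀`. So `P` is invariant under `Ref`, which is absurd as `dim V ≥ 4`.

**The scalar case** (`finite_Ref_of_scalar`). Some power of `M₀` lies in `H`, so it is scalar, and it
is `1` because `M₀` fixes a hyperplane pointwise. Determinants on `Ref` are thus roots of unity of bounded
order, so `H` is finite, and so is `Ref`. Finally, `Mon` acts on the finite group `Ref` by
conjugation with scalar kernel, and the same determinant argument makes that kernel finite
(`finite_Mon_of_finite_Ref`).
-/

namespace LauricellaFC

open Matrix

/-! ### Reflections and Clifford theory -/

/-- A subspace of dimension at least two meets every hyperplane. -/
theorem exists_ne_zero_dotProduct_eq_zero {ι : Type*} [Fintype ι] {W : Submodule ℂ (ι → ℂ)}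
    (hW : 1 < Module.finrank ℂ W) (v : ι → ℂ) : ∃ x ∈ W, x ≠ 0 ∧ v ⬝ᵥ x = 0 := by
  let φ : W →ₗ[ℂ] ℂ := (dotProductBilin ℂ ℂ v).comp W.subtype
  have hk : LinearMap.ker φ ≠ ⊥ := by
    apply LinearMap.ker_ne_bot_of_finrank_lt
    simpa using hW
  obtain ⟨x, hx, hx0⟩ := Submodule.exists_mem_ne_zero_of_ne_bot hk
  exact ⟨x, x.2, by simpa using hx0, hx⟩

theorem exists_eq_smul_of_finrank_le_one {ι : Type*} [Fintype ι] {W : Submodule ℂ (ι → ℂ)}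
    (hW : Module.finrank ℂ W ≤ 1) {x y : ι → ℂ} (hx : x ∈ W) (hx0 : x ≠ 0) (hy : y ∈ W) :
    ∃ c : ℂ, y = c • x := by
  obtain ⟨w, hw⟩ := finrank_le_one_iff.1 hW
  obtain ⟨c, hc⟩ := hw ⟨x, hx⟩
  obtain ⟨d, hd⟩ := hw ⟨y, hy⟩
  have hc' : c • (w : ι → ℂ) = x := congrArg Subtype.val hc
  have hd' : d • (w : ι → ℂ) = y := congrArg Subtype.val hd
  have hc0 : c ≠ 0 := by
    rintro rfl
    exact hx0 (by rw [← hc', zero_smul])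
  exact ⟨d * c⁻¹, by rw [← hc', smul_smul, inv_mul_cancel_right₀ hc0, hd']⟩

section Reflections

universe u

variable {ι : Type u} [Fintype ι] [DecidableEq ι]

/-- The subgroup of `GL` of elements mapping the subspace `W` into itself. It is closed under
inverses because `W` is finite-dimensional. -/
def stab (W : Submodule ℂ (ι → ℂ)) : Subgroup (GL ι ℂ) where
  carrier := {g | ∀ x ∈ W, g.1 *ᵥ x ∈ W}
  one_mem' := by simp
  mul_mem' := by
    intro g h hg hh x hx
    simpa [← mulVec_mulVec] using hg _ (hh x hx)
  inv_mem' := by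
    intro g hg x hx
    have hinj : Function.Injective ((mulVecLin g.1).restrict (p := W) (q := W) hg) := by
      intro y z hyz
      have h1 : g.1 *ᵥ y.1 = g.1 *ᵥ z.1 := congrArg Subtype.val hyz
      have h2 := congrArg (fun w => (g⁻¹).1 *ᵥ w) h1
      simpa [mulVec_mulVec, ← Units.val_mul] using h2
    obtain ⟨y, hy⟩ := LinearMap.injective_iff_surjective.1 hinj ⟨x, hx⟩
    have h1 : g.1 *ᵥ y.1 = x := congrArg Subtype.val hy
    rw [← h1]
    simp only [mulVec_mulVec, ← Units.val_mul, inv_mul_cancel, Units.val_one, one_mulVec]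
    exact y.2

theorem inv_mulVec_mulVec (g : GL ι ℂ) (x : ι → ℂ) : (g⁻¹).1 *ᵥ (g.1 *ᵥ x) = x := by
  rw [mulVec_mulVec, ← Units.val_mul]; simp

theorem mulVec_inv_mulVec (g : GL ι ℂ) (x : ι → ℂ) : g.1 *ᵥ ((g⁻¹).1 *ᵥ x) = x := by
  rw [mulVec_mulVec, ← Units.val_mul]; simp

theorem mulVec_ne_zero (g : GL ι ℂ) {x : ι → ℂ} (hx : x ≠ 0) : g.1 *ᵥ x ≠ 0 := by
  intro h
  apply hx
  rw [← inv_mulVec_mulVec g x, h, mulVec_zero]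

theorem conj_mulVec (g h : GL ι ℂ) (x : ι → ℂ) :
    h.1 *ᵥ (g.1 *ᵥ x) = g.1 *ᵥ ((g⁻¹ * h * g).1 *ᵥ x) := by
  rw [mulVec_mulVec, mulVec_mulVec, ← Units.val_mul, ← Units.val_mul]
  congr 2
  group

/-- Irreducibility in terms of invariant subspaces. -/
theorem actsIrreducibly_iff [Nonempty ι] (G : Subgroup (GL ι ℂ)) :
    ActsIrreducibly G ↔ ∀ W : Submodule ℂ (ι → ℂ), G ≤ stab W → W = ⊥ ∨ W = ⊤ := by
  constructor
  · intro h W hW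
    have h' : IsSimpleOrder (Subrepresentation (standardRep G)) := h
    rcases h'.eq_bot_or_eq_top ⟨W, fun g x hx => hW g.2 x hx⟩ with h1 | h1
    · exact Or.inl (congrArg Subrepresentation.toSubmodule h1)
    · exact Or.inr (congrArg Subrepresentation.toSubmodule h1)
  · intro h
    refine @IsSimpleOrder.mk _ _ _ ?_ ?_
    · refine ⟨⊥, ⊤, fun hbt => ?_⟩
      have h1 : (⊥ : Submodule ℂ (ι → ℂ)) = ⊤ := congrArg Subrepresentation.toSubmodule hbt
      exact bot_ne_top h1
    · intro W
      rcases h W.toSubmodule (fun g hg x hx => W.apply_mem_toSubmodule ⟨g, hg⟩ hx) with h1 | h1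
      · exact Or.inl (Subrepresentation.toSubmodule_injective h1)
      · exact Or.inr (Subrepresentation.toSubmodule_injective h1)

/-- `g` is the identity plus an endomorphism of rank at most one: it is a (pseudo)reflection, a
transvection, or the identity. -/
def IsReflection (g : GL ι ℂ) : Prop :=
  ∃ v u : ι → ℂ, ∀ x, g.1 *ᵥ x = x - (v ⬝ᵥ x) • u

/-- The weight space of a function `χ` on `H`: the common eigenvectors of `H` on which `h` acts
as `χ h`. -/
def weightSpace (H : Subgroup (GL ι ℂ)) (χ : H → ℂ) : Submodule ℂ (ι → ℂ) where
  carrier := {x | ∀ h : H, h.1.1 *ᵥ x = χ h • x}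
  zero_mem' := by simp
  add_mem' := by
    intro x y hx hy h
    rw [mulVec_add, hx h, hy h, smul_add]
  smul_mem' := by
    intro c x hx h
    rw [mulVec_smul, hx h, smul_comm]

theorem exists_weight_mulVec {H M : Subgroup (GL ι ℂ)}
    (hMH : ∀ g ∈ M, ∀ h ∈ H, g * h * g⁻¹ ∈ H) {g : GL ι ℂ} (hgM : g ∈ M) (χ : H → ℂ) :
    ∃ χ' : H → ℂ, ∀ x ∈ weightSpace H χ, g.1 *ᵥ x ∈ weightSpace H χ' := by
  have hg : ∀ h ∈ H, g⁻¹ * h * g ∈ H := fun h hh => by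
    simpa using hMH g⁻¹ (M.inv_mem hgM) h hh
  refine ⟨fun h => χ ⟨g⁻¹ * h.1 * g, hg _ h.2⟩, fun x hx h => ?_⟩
  rw [conj_mulVec, hx ⟨g⁻¹ * h.1 * g, hg _ h.2⟩, mulVec_smul]

theorem weight_unique {H : Subgroup (GL ι ℂ)} {χ χ' : H → ℂ} {x : ι → ℂ} (hx : x ≠ 0)
    (h : x ∈ weightSpace H χ) (h' : x ∈ weightSpace H χ') : χ = χ' := by
  funext g
  exact smul_left_injective ℂ hx ((h g).symm.trans (h' g))

/-- If reflections normalizing `H` generate an irreducible group while `H` is reducible, then `H`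
has a common eigenvector: a minimal `H`-invariant subspace of dimension at least two would be
preserved by all the reflections. -/
theorem exists_weightSpace_ne_bot [Nonempty ι] {S : Set (GL ι ℂ)}
    {H M : Subgroup (GL ι ℂ)} (hS : ∀ r ∈ S, IsReflection r) (hSM : ∀ r ∈ S, r ∈ M)
    (hMH : ∀ g ∈ M, ∀ h ∈ H, g * h * g⁻¹ ∈ H)
    (hirr : ActsIrreducibly (Subgroup.closure S)) (hred : ¬ ActsIrreducibly H) :
    ∃ χ, weightSpace H χ ≠ ⊥ := by
  obtain ⟨W, ⟨hW0, hWH⟩, hmin⟩ := (wellFounded_lt (α := Submodule ℂ (ι → ℂ))).has_min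
    {W | W ≠ ⊥ ∧ H ≤ stab W} ⟨⊤, top_ne_bot, fun g _ x _ => trivial⟩
  have hmin' : ∀ W', W' ≠ ⊥ → H ≤ stab W' → W' ≤ W → W' = W := by
    intro W' h0 h1 h2
    by_contra hne
    exact hmin W' ⟨h0, h1⟩ (lt_of_le_of_ne h2 hne)
  rcases le_or_gt (Module.finrank ℂ W) 1 with h1 | h1
  · obtain ⟨x, hx, hx0⟩ := Submodule.exists_mem_ne_zero_of_ne_bot hW0
    choose χ hχ using fun h : H =>
      exists_eq_smul_of_finrank_le_one h1 hx hx0 (hWH h.2 x hx)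
    exact ⟨χ, fun hbot => hx0 ((Submodule.eq_bot_iff _).1 hbot x hχ)⟩
  · exfalso
    have hstab : Subgroup.closure S ≤ stab W := by
      rw [Subgroup.closure_le]
      intro r hr x hx
      obtain ⟨v, u, hvu⟩ := hS r hr
      -- The part of `W` mapped into `W` by `r` is invariant under `H`, and it contains the
      -- intersection of `W` with the hyperplane fixed by `r`.
      have key : W ⊓ W.comap (mulVecLin r.1) = W := by
        refine hmin' _ ?_ ?_ inf_le_left
        · obtain ⟨y, hyW, hy0, hvy⟩ := exists_ne_zero_dotProduct_eq_zero h1 v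
          refine (Submodule.ne_bot_iff _).2 ⟨y, ⟨hyW, ?_⟩, hy0⟩
          change r.1 *ᵥ y ∈ W
          rw [hvu, hvy, zero_smul, sub_zero]
          exact hyW
        · rintro h hh y ⟨hy1, hy2⟩
          refine ⟨hWH hh y hy1, ?_⟩
          change r.1 *ᵥ (h.1 *ᵥ y) ∈ W
          have h3 := hWH (hMH r (hSM r hr) h hh) _ hy2
          rw [mulVecLin_apply, mulVec_mulVec, ← Units.val_mul] at h3
          rw [mulVec_mulVec, ← Units.val_mul]
          simpa using h3
      exact (key.ge hx).2
    have htop : W = ⊤ := ((actsIrreducibly_iff _).1 hirr W hstab).resolve_left hW0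
    refine hred ((actsIrreducibly_iff _).2 fun W' hW' => ?_)
    by_cases h0 : W' = ⊥
    · exact Or.inl h0
    · exact Or.inr ((hmin' W' h0 hW' (htop ▸ le_top)).trans htop)

theorem weightSpace_eq_top_or_finrank_le_one [Nonempty ι] {S : Set (GL ι ℂ)}
    {H M : Subgroup (GL ι ℂ)} (hS : ∀ r ∈ S, IsReflection r) (hSM : ∀ r ∈ S, r ∈ M)
    (hMH : ∀ g ∈ M, ∀ h ∈ H, g * h * g⁻¹ ∈ H)
    (hirr : ActsIrreducibly (Subgroup.closure S)) (χ : H → ℂ) :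
    weightSpace H χ = ⊤ ∨ Module.finrank ℂ (weightSpace H χ) ≤ 1 := by
  rcases le_or_gt (Module.finrank ℂ (weightSpace H χ)) 1 with h1 | h1
  · exact Or.inr h1
  refine Or.inl (((actsIrreducibly_iff _).1 hirr _ ?_).resolve_left ?_)
  · rw [Subgroup.closure_le]
    intro r hr
    obtain ⟨v, u, hvu⟩ := hS r hr
    obtain ⟨y, hyW, hy0, hvy⟩ := exists_ne_zero_dotProduct_eq_zero h1 v
    have hry : r.1 *ᵥ y = y := by rw [hvu, hvy, zero_smul, sub_zero]
    obtain ⟨χ', hχ'⟩ := exists_weight_mulVec hMH (hSM r hr) χ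
    -- `r` fixes a nonzero vector of the weight space, so it cannot change the weight.
    have h2 : χ = χ' := weight_unique hy0 hyW (hry ▸ hχ' y hyW)
    rw [← h2] at hχ'
    exact hχ'
  · intro h0
    rw [h0, finrank_bot] at h1
    omega

theorem iSup_weightSpace_eq_top [Nonempty ι] {H M R : Subgroup (GL ι ℂ)}
    (hMH : ∀ g ∈ M, ∀ h ∈ H, g * h * g⁻¹ ∈ H) (hRM : R ≤ M)
    (hirr : ActsIrreducibly R) {χ₀ : H → ℂ} (hχ₀ : weightSpace H χ₀ ≠ ⊥) :
    ⨆ χ, weightSpace H χ = ⊤ := by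
  refine ((actsIrreducibly_iff _).1 hirr _ ?_).resolve_left ?_
  · intro g hg x hx
    change x ∈ (⨆ χ, weightSpace H χ).comap (mulVecLin g.1)
    revert x
    change (⨆ χ, weightSpace H χ) ≤ _
    refine iSup_le fun χ x hx => ?_
    obtain ⟨χ', hχ'⟩ := exists_weight_mulVec hMH (hRM hg) χ
    exact Submodule.mem_iSup_of_mem χ' (hχ' x hx)
  · intro h0
    exact hχ₀ (le_bot_iff.1 (h0 ▸ le_iSup (weightSpace H) χ₀))

theorem iSupIndep_weightSpace {H : Subgroup (GL ι ℂ)} (htop : ⨆ χ, weightSpace H χ = ⊤) :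
    iSupIndep (weightSpace H) := by
  let F : H → Module.End ℂ (ι → ℂ) := fun h => mulVecLin h.1.1
  -- The elements of `H` commute because they are diagonal on the sum of the weight spaces.
  have hcomm : ∀ h h', Commute (F h) (F h') := by
    intro h h'
    have : (⊤ : Submodule ℂ (ι → ℂ)) ≤ LinearMap.eqLocus (F h * F h') (F h' * F h) := by
      rw [← htop]
      refine iSup_le fun χ x hx => ?_
      change h.1.1 *ᵥ (h'.1.1 *ᵥ x) = h'.1.1 *ᵥ (h.1.1 *ᵥ x)
      rw [hx h, hx h', mulVec_smul, mulVec_smul, hx h, hx h', smul_comm]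
    exact LinearMap.ext fun x => this trivial
  refine (Module.End.independent_iInf_maxGenEigenspace_of_forall_mapsTo F fun i j φ =>
    Module.End.mapsTo_maxGenEigenspace_of_comm (hcomm j i) φ).mono fun χ x hx => ?_
  rw [Module.End.mem_iInf_maxGenEigenspace_iff]
  intro h
  refine ⟨1, ?_⟩
  have := hx h
  simpa [F, sub_eq_zero] using this

/-- The matrix `A` maps each vector of the family `f` to a multiple of a vector of `f`. The multiple
may be zero, but not for invertible `A` and nonzero vectors. -/
def IsMonomial {κ : Type*} (f : κ → ι → ℂ) (A : Matrix ι ι ℂ) : Prop :=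
  ∀ i, ∃ j, ∃ c : ℂ, A *ᵥ f i = c • f j

/-- Clifford theory for a group generated by reflections: if reflections in `M` generate an
irreducible group and `H` is a reducible subgroup normalized by `M`, then either `H` acts by scalars
or `M` permutes the lines of a basis. -/
theorem scalar_or_monomial [Nonempty ι] {S : Set (GL ι ℂ)}
    {H M : Subgroup (GL ι ℂ)} (hS : ∀ r ∈ S, IsReflection r) (hSM : ∀ r ∈ S, r ∈ M)
    (hMH : ∀ g ∈ M, ∀ h ∈ H, g * h * g⁻¹ ∈ H)
    (hirr : ActsIrreducibly (Subgroup.closure S)) (hred : ¬ ActsIrreducibly H) :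
    (∀ h ∈ H, ∃ c : ℂ, h.1 = c • 1) ∨
      ∃ (κ : Type u) (f : Module.Basis κ ℂ (ι → ℂ)), ∀ g ∈ M, IsMonomial f g.1 := by
  obtain ⟨χ₀, hχ₀⟩ := exists_weightSpace_ne_bot hS hSM hMH hirr hred
  have htop := iSup_weightSpace_eq_top hMH ((Subgroup.closure_le _).2 hSM) hirr hχ₀
  have hdim := weightSpace_eq_top_or_finrank_le_one hS hSM hMH hirr
  by_cases hex : ∃ χ, weightSpace H χ = ⊤
  · obtain ⟨χ, hχ⟩ := hex
    refine Or.inl fun h hh => ⟨χ ⟨h, hh⟩, ?_⟩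
    have hx : ∀ x, x ∈ weightSpace H χ := fun x => hχ ▸ trivial
    refine Matrix.toLin'.injective (LinearMap.ext fun x => ?_)
    rw [toLin'_apply, toLin'_apply, smul_mulVec, one_mulVec]
    exact hx x ⟨h, hh⟩
  · push Not at hex
    refine Or.inr ?_
    have hne : ∀ χ : {χ // weightSpace H χ ≠ ⊥}, ∃ x ∈ weightSpace H χ.1, x ≠ 0 := fun χ =>
      Submodule.exists_mem_ne_zero_of_ne_bot χ.2
    choose f hf hf0 using hne
    have hline : ∀ (χ : {χ // weightSpace H χ ≠ ⊥}), ∀ y ∈ weightSpace H χ.1,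
        ∃ c : ℂ, y = c • f χ := fun χ y hy =>
      exists_eq_smul_of_finrank_le_one ((hdim χ.1).resolve_left (hex _)) (hf χ) (hf0 χ) hy
    have hli : LinearIndependent ℂ f :=
      iSupIndep.linearIndependent (fun χ : {χ // weightSpace H χ ≠ ⊥} => weightSpace H χ.1)
        ((iSupIndep_weightSpace htop).comp Subtype.val_injective) hf hf0
    have hspan : ⊤ ≤ Submodule.span ℂ (Set.range f) := by
      rw [← htop]
      refine iSup_le fun χ y hy => ?_
      by_cases h0 : weightSpace H χ = ⊥
      · rw [h0, Submodule.mem_bot] at hy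
        rw [hy]
        exact zero_mem _
      · obtain ⟨c, rfl⟩ := hline ⟨χ, h0⟩ y hy
        exact Submodule.smul_mem _ _ (Submodule.subset_span ⟨_, rfl⟩)
    refine ⟨{χ // weightSpace H χ ≠ ⊥}, Module.Basis.mk hli hspan, fun g hg => ?_⟩
    rw [Module.Basis.coe_mk]
    intro χ
    obtain ⟨χ', hχ'⟩ := exists_weight_mulVec hMH hg χ.1
    have h1 := hχ' _ (hf χ)
    have h0 : weightSpace H χ' ≠ ⊥ :=
      (Submodule.ne_bot_iff _).2 ⟨_, h1, mulVec_ne_zero g (hf0 χ)⟩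
    exact ⟨⟨χ', h0⟩, hline ⟨χ', h0⟩ _ h1⟩

end Reflections

/-! ### The identity component in the Zariski topology -/

section IdentityComponent

/-- In a group with a Noetherian topology and continuous left translations, the component of `1`
in a subgroup `K` has finite index: two elements of `K` in the same irreducible component differ by
an element of it, and a Noetherian space has finitely many irreducible components. -/
theorem finiteIndex_of_connectedComponentIn {X : Type*} [Group X] [TopologicalSpace X]
    [TopologicalSpace.NoetherianSpace X] (hl : ∀ g : X, Continuous fun x => g * x)
    (K H : Subgroup X) (hH : connectedComponentIn (K : Set X) 1 ⊆ H) :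
    (H.subgroupOf K).FiniteIndex := by
  have : TopologicalSpace.NoetherianSpace K := Topology.IsInducing.subtypeVal.noetherianSpace
  have hfin : Finite (irreducibleComponents K) :=
    TopologicalSpace.NoetherianSpace.finite_irreducibleComponents.to_subtype
  let φ : K ⧸ H.subgroupOf K → irreducibleComponents K := fun q =>
    ⟨irreducibleComponent q.out, irreducibleComponent_mem_irreducibleComponents _⟩
  have hφ : Function.Injective φ := by
    intro p q hpq
    have hxy : irreducibleComponent p.out = irreducibleComponent q.out :=
      congrArg Subtype.val hpq
    have hx : p.out ∈ connectedComponent q.out :=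
      irreducibleComponent_subset_connectedComponent (hxy ▸ mem_irreducibleComponent)
    have hpre : IsPreconnected
        ((fun z : K => (p.out : X)⁻¹ * z) '' connectedComponent q.out) :=
      isPreconnected_connectedComponent.image _
        ((hl _).comp continuous_subtype_val).continuousOn
    rw [← q.out_eq, ← p.out_eq]
    refine QuotientGroup.eq.2 (hH ?_)
    refine hpre.subset_connectedComponentIn ⟨_, hx, inv_mul_cancel _⟩ ?_
      ⟨_, mem_connectedComponent, rfl⟩
    rintro _ ⟨z, -, rfl⟩
    exact K.mul_mem (K.inv_mem p.out.2) z.2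
  have := Finite.of_injective φ hφ
  exact Subgroup.finiteIndex_of_finite_quotient

variable {ι : Type*} [Fintype ι] [DecidableEq ι]

theorem noetherianSpace_zariski : @TopologicalSpace.NoetherianSpace _ (zariskiTopology ι) := by
  let _ := zariskiTopology ι
  let I : TopologicalSpace.Opens (GL ι ℂ) → Ideal (MvPolynomial (ι × ι) ℂ) := fun U =>
    ⨅ g : {g : GL ι ℂ // g ∉ U},
      RingHom.ker (MvPolynomial.eval fun ij : ι × ι => g.1.1 ij.1 ij.2)
  have hI : ∀ (U : TopologicalSpace.Opens (GL ι ℂ)) p, p ∈ I U ↔ ∀ g ∉ U,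
      MvPolynomial.eval (fun ij : ι × ι => g.1 ij.1 ij.2) p = 0 := by
    intro U p
    simp [I, Submodule.mem_iInf, RingHom.mem_ker]
  have hle : ∀ U U', I U ≤ I U' → U ≤ U' := by
    intro U U' h g hg
    obtain ⟨P, hP⟩ := (isClosed_zariski_iff _).1 U.isOpen.isClosed_compl
    by_contra hg'
    have : g ∈ zeroSet P := fun p hp => by
      refine (hI U' p).1 (h ((hI U p).2 fun x hx => ?_)) g hg'
      have hx' : x ∈ zeroSet P := hP ▸ hx
      exact hx' p hp
    rw [← hP] at this
    exact this hg
  have hmono : StrictMono I := by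
    intro U U' h
    refine lt_of_le_not_ge (fun p hp => (hI U' p).2 fun g hg => (hI U p).1 hp g fun hgU =>
      hg (h.le hgU)) fun h' => h.not_ge (hle _ _ h')
  exact hmono.wellFoundedGT

theorem continuous_mul_right_zariski (g : GL ι ℂ) :
    @Continuous _ _ (zariskiTopology ι) (zariskiTopology ι) (fun x => x * g) := by
  let _ := zariskiTopology ι
  rw [continuous_iff_isClosed]
  intro S hS
  obtain ⟨P, rfl⟩ := (isClosed_zariski_iff S).1 hS
  rw [isClosed_zariski_iff]
  let F : ι × ι → MvPolynomial (ι × ι) ℂ := fun ij =>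
    ∑ k, MvPolynomial.X (ij.1, k) * MvPolynomial.C (g.1 k ij.2)
  have key : ∀ (x : GL ι ℂ) (p : MvPolynomial (ι × ι) ℂ),
      MvPolynomial.eval (fun ij : ι × ι => x.1 ij.1 ij.2) (MvPolynomial.bind₁ F p) =
      MvPolynomial.eval (fun ij : ι × ι => (x * g).1 ij.1 ij.2) p := by
    intro x p
    rw [← MvPolynomial.coe_aeval_eq_eval, ← MvPolynomial.coe_aeval_eq_eval]
    simp only [RingHom.coe_coe]
    rw [MvPolynomial.aeval_bind₁]
    simp [F, Matrix.mul_apply]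
  refine ⟨MvPolynomial.bind₁ F '' P, ?_⟩
  ext x
  constructor
  · rintro hx _ ⟨p, hp, rfl⟩
    exact (key x p).trans (hx p hp)
  · intro hx p hp
    exact (key x p).symm.trans (hx _ ⟨p, hp, rfl⟩)

theorem identityComponent_le (G : Subgroup (GL ι ℂ)) : identityComponent G ≤ G :=
  @connectedComponentIn_subset _ (zariskiTopology ι) (G : Set (GL ι ℂ)) 1

theorem finiteIndex_identityComponent (G : Subgroup (GL ι ℂ)) :
    ((identityComponent G).subgroupOf G).FiniteIndex :=
  @finiteIndex_of_connectedComponentIn _ _ (zariskiTopology ι) noetherianSpace_zariski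
    continuous_mul_left_zariski G (identityComponent G) fun _ h => h

theorem conj_mem_identityComponent {G : Subgroup (GL ι ℂ)} {g : GL ι ℂ}
    (hg : ∀ x ∈ G, g * x * g⁻¹ ∈ G) {h : GL ι ℂ} (hh : h ∈ identityComponent G) :
    g * h * g⁻¹ ∈ identityComponent G := by
  let _ := zariskiTopology ι
  have hcont : Continuous fun x : GL ι ℂ => g * x * g⁻¹ :=
    (continuous_mul_right_zariski g⁻¹).comp (continuous_mul_left_zariski g)
  have hpre : IsPreconnected ((fun x => g * x * g⁻¹) ''
      connectedComponentIn (G : Set (GL ι ℂ)) 1) :=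
    isPreconnected_connectedComponentIn.image _ hcont.continuousOn
  refine hpre.subset_connectedComponentIn ⟨1, mem_connectedComponentIn G.one_mem, by simp⟩ ?_
    ⟨h, hh, rfl⟩
  rintro _ ⟨z, hz, rfl⟩
  exact hg z (connectedComponentIn_subset _ _ hz)

end IdentityComponent

/-! ### The monodromy matrices and their products -/

section Tensor

variable {n : ℕ}

theorem tensor_update_apply (B : Fin n → Matrix (Fin 2) (Fin 2) ℂ) (k : Fin n)
    (A : Matrix (Fin 2) (Fin 2) ℂ) (I J : Idx n) :
    tensor (Function.update B k A) I J =
      A (I k) (J k) * ∏ j ∈ Finset.univ.erase k, B j (I j) (J j) := by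
  rw [tensor, of_apply, ← Finset.mul_prod_erase _ _ (Finset.mem_univ k)]
  congr 1
  · simp
  · refine Finset.prod_congr rfl fun j hj => ?_
    rw [Function.update_of_ne (Finset.ne_of_mem_erase hj)]

theorem matG_mul_self (z : ℂ) :
    matG z * matG z = (1 + z⁻¹) • matG z - z⁻¹ • 1 := by
  ext x y
  fin_cases x <;> fin_cases y <;> simp [matG, Matrix.mul_apply] <;> ring

/-- Every `M_k` is annihilated by `(X - 1) (X - γ_k⁻¹)`. -/
theorem matM_mul_self (c : Fin n → ℂ) (k : Fin n) :
    matM c k * matM c k =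
      (1 + (expTwoPiI (c k))⁻¹) • matM c k - (expTwoPiI (c k))⁻¹ • 1 := by
  have h1 : matM c k * matM c k = tensor (Function.update (fun _ => 1) k
      (matG (expTwoPiI (c k)) * matG (expTwoPiI (c k)))) := by
    rw [matM, tensor_mul]
    congr 1
    funext j
    by_cases hj : j = k
    · subst hj; simp
    · simp [hj]
  have h2 : (1 : Matrix (Idx n) (Idx n) ℂ) = tensor (Function.update (fun _ => 1) k 1) := by
    rw [Function.update_eq_self_iff.2 rfl, tensor_one]
  rw [h1, matG_mul_self, h2]
  ext I J
  simp only [matM, tensor_update_apply, Matrix.sub_apply, Matrix.smul_apply, smul_eq_mul]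
  ring

/-- The product `∏_{k ∈ I} M_k` of the commuting matrices `M_k`. -/
noncomputable def matProd (c : Fin n → ℂ) (I : Finset (Fin n)) : Matrix (Idx n) (Idx n) ℂ :=
  tensor fun k => if k ∈ I then matG (expTwoPiI (c k)) else 1

theorem matProd_empty (c : Fin n → ℂ) : matProd c ∅ = 1 := by
  simp [matProd, tensor_one]

theorem matProd_singleton (c : Fin n → ℂ) (k : Fin n) : matProd c {k} = matM c k := by
  unfold matProd matM
  congr 1
  funext j
  by_cases hj : j = k
  · subst hj; simp
  · simp [hj]

theorem matProd_commute (c : Fin n → ℂ) (I J : Finset (Fin n)) :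
    Commute (matProd c I) (matProd c J) := by
  rw [Commute, SemiconjBy, matProd, matProd, tensor_mul, tensor_mul]
  congr 1
  funext k
  split_ifs <;> simp

/-- `M_k` is an involution if `γ_k = -1`. -/
theorem matProd_mul_matProd (c : Fin n → ℂ) {I J : Finset (Fin n)}
    (h : ∀ k ∈ I, expTwoPiI (c k) = -1) :
    matProd c I * matProd c J = matProd c (symmDiff I J) := by
  rw [matProd, matProd, tensor_mul, matProd]
  congr 1
  funext k
  by_cases hI : k ∈ I <;> by_cases hJ : k ∈ J <;> simp [hI, hJ, Finset.mem_symmDiff]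
  rw [h k hI, matG_mul_self]
  ext x y
  simp [inv_neg]

theorem matProd_mul_self (c : Fin n → ℂ) {I : Finset (Fin n)}
    (h : ∀ k ∈ I, expTwoPiI (c k) = -1) : matProd c I * matProd c I = 1 := by
  rw [matProd_mul_matProd c h, symmDiff_self, Finset.bot_eq_empty, matProd_empty]

/-- The product of the `M_k`, `k ∈ I`, maps the root of `M₀` into the hyperplane fixed by `M₀`, if
some `γ_k` with `k ∈ I` is `-1` and `I` is not everything. In general, the value of `v` at
that vector is `∏_{k ∈ I} (1 + γ_k⁻¹)`. -/
theorem vecV_dotProduct_matProd (a b : ℂ) (c : Fin n → ℂ) {I : Finset (Fin n)} {k l : Fin n}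
    (hk : k ∈ I) (hγ : expTwoPiI (c k) = -1) (hl : l ∉ I) :
    vecV a b c ⬝ᵥ (matProd c I *ᵥ Pi.single 1 1) = 0 := by
  have ha := expTwoPiI_ne_zero a
  have hb := expTwoPiI_ne_zero b
  -- `w` is the image of the root, a pure tensor.
  let w : Fin n → Fin 2 → ℂ := fun j x =>
    (if j ∈ I then matG (expTwoPiI (c j)) else 1) x 1
  -- On the support of `w`, the vector `v` is the sum of two pure tensors.
  have hsplit : ∀ K : Idx n, vecV a b c K * ∏ j, w j (K j) =
      (-1) ^ n * (∏ j, ((-1) ^ (K j : ℕ) * expTwoPiI (c j) ^ (1 - (K j : ℕ))) * w j (K j)) +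
      (-1) ^ n * (∏ j, expTwoPiI (c j)) / (expTwoPiI a * expTwoPiI b) * ∏ j, w j (K j) := by
    intro K
    by_cases hK : K = 0
    · have : w l (K l) = 0 := by simp [w, hl, hK]
      rw [Finset.prod_eq_zero (f := fun j => w j (K j)) (Finset.mem_univ l) this,
        Finset.prod_eq_zero (Finset.mem_univ l) (by rw [this, mul_zero])]
      simp
    · rw [Finset.prod_mul_distrib, Finset.prod_mul_distrib, Finset.prod_pow_eq_pow_sum]
      have hg : ∏ j, expTwoPiI (c j) =
          (∏ j, expTwoPiI (c j) ^ (K j : ℕ)) * ∏ j, expTwoPiI (c j) ^ (1 - (K j : ℕ)) := by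
        rw [← Finset.prod_mul_distrib]
        refine Finset.prod_congr rfl fun j _ => ?_
        rw [← pow_add, Nat.add_sub_cancel' (Nat.lt_succ_iff.1 (K j).2), pow_one]
      have hs : ((-1 : ℂ) ^ (∑ j, (K j : ℕ))) * (-1) ^ (∑ j, (K j : ℕ)) = 1 := by
        rw [← mul_pow]; simp
      simp only [vecV, hK, if_false]
      rw [hg, pow_add]
      field_simp
      linear_combination (∏ j, expTwoPiI (c j) ^ (K j : ℕ)) *
        (∏ j, expTwoPiI (c j) ^ (1 - (K j : ℕ))) * (∏ j, w j (K j)) * hs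
  have hw : ∀ K : Idx n, (matProd c I *ᵥ Pi.single 1 1) K = ∏ j, w j (K j) := by
    intro K
    simp [matProd, tensor, w]
  -- Both sums factor, and both have a vanishing factor at `k`.
  have h1 : ∑ K : Idx n, ∏ j, ((-1) ^ (K j : ℕ) * expTwoPiI (c j) ^ (1 - (K j : ℕ))) * w j (K j)
      = 0 := by
    rw [← Fintype.piFinset_univ, ← Finset.prod_univ_sum (fun _ => Finset.univ) fun j (x : Fin 2) =>
      ((-1) ^ (x : ℕ) * expTwoPiI (c j) ^ (1 - (x : ℕ))) * w j x]
    refine Finset.prod_eq_zero (Finset.mem_univ k) ?_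
    simp [w, hk, hγ, matG]
  have h2 : ∑ K : Idx n, ∏ j, w j (K j) = 0 := by
    rw [← Fintype.piFinset_univ, ← Finset.prod_univ_sum (fun _ => Finset.univ) w]
    refine Finset.prod_eq_zero (Finset.mem_univ k) ?_
    simp [w, hk, matG]
  rw [dotProduct]
  simp only [hw, hsplit]
  rw [Finset.sum_add_distrib, ← Finset.mul_sum, ← Finset.mul_sum, h1, h2]
  simp

theorem matM₀_mulVec (a b : ℂ) (c : Fin n → ℂ) (x : Idx n → ℂ) :
    matM₀ a b c *ᵥ x = x - (vecV a b c ⬝ᵥ x) • Pi.single 1 1 := by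
  rw [matM₀, sub_mulVec, one_mulVec]
  congr 1
  ext I
  by_cases hI : I = 1
  · subst hI
    simp [matN₀, mulVec]
  · simp [matN₀, mulVec, hI]

theorem matM_mulVec_single_zero (c : Fin n → ℂ) (k : Fin n) :
    matM c k *ᵥ Pi.single 0 1 = Pi.single 0 1 := by
  have h : matM c k = 1 + tensor (Function.update (fun _ => 1) k
      (matG (expTwoPiI (c k)) - 1)) := by
    have h2 : (1 : Matrix (Idx n) (Idx n) ℂ) = tensor (Function.update (fun _ => 1) k 1) := by
      rw [Function.update_eq_self_iff.2 rfl, tensor_one]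
    rw [h2]
    ext I J
    simp only [matM, tensor_update_apply, Matrix.add_apply, Matrix.sub_apply]
    ring
  rw [h, add_mulVec, one_mulVec]
  ext I
  have : ∀ x : Fin 2, (matG (expTwoPiI (c k)) - 1) x 0 = 0 := by
    intro x
    fin_cases x <;> simp [matG]
  simp [tensor_update_apply, this]

end Tensor

section Generators

variable {n : ℕ}

/-- The group generated by the commuting matrices `M₁, …, Mₙ`. -/
def torus (c : Fin n → ℂ) : Subgroup (GL (Idx n) ℂ) :=
  Subgroup.closure {g | ∃ k, g.1 = matM c k}

theorem torus_le_Mon (a b : ℂ) (c : Fin n → ℂ) : torus c ≤ Mon a b c :=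
  Subgroup.closure_mono fun _ hg => Or.inr hg

/-- Modulo a subgroup `D` containing the `M_k` with `γ_k ≠ -1`, every element of the group generated
by the `M_k` is a product of distinct involutions `M_k` with `γ_k = -1`. -/
theorem exists_matProd_of_mem_torus {c : Fin n → ℂ} {D : Subgroup (GL (Idx n) ℂ)}
    (hD : ∀ (g : GL (Idx n) ℂ) (k : Fin n), g.1 = matM c k → expTwoPiI (c k) ≠ -1 → g ∈ D)
    {t : GL (Idx n) ℂ} (ht : t ∈ torus c) :
    ∃ I : Finset (Fin n), (∀ k ∈ I, expTwoPiI (c k) = -1) ∧ ∃ d ∈ D, t.1 = matProd c I * d.1 := by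
  have step : ∀ (x : GL (Idx n) ℂ) (k : Fin n), x.1 = matM c k → ∀ y : GL (Idx n) ℂ,
      (∃ I : Finset (Fin n), (∀ k ∈ I, expTwoPiI (c k) = -1) ∧
        ∃ d ∈ D, y.1 = matProd c I * d.1) →
      (∃ I : Finset (Fin n), (∀ k ∈ I, expTwoPiI (c k) = -1) ∧
        ∃ d ∈ D, (x * y).1 = matProd c I * d.1) ∧
      (∃ I : Finset (Fin n), (∀ k ∈ I, expTwoPiI (c k) = -1) ∧
        ∃ d ∈ D, (x⁻¹ * y).1 = matProd c I * d.1) := by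
    rintro x k hx y ⟨I, hI, d, hd, hy⟩
    by_cases hk : expTwoPiI (c k) = -1
    · have hk' : ∀ j ∈ ({k} : Finset (Fin n)), expTwoPiI (c j) = -1 := by simpa using hk
      have hinv : (x⁻¹).1 = matM c k := by
        have h1 := matProd_mul_self c hk'
        rw [matProd_singleton, ← hx] at h1
        rw [← hx]
        exact (Units.inv_eq_of_mul_eq_one_right h1)
      have hJ : ∀ j ∈ symmDiff {k} I, expTwoPiI (c j) = -1 := by
        intro j hj
        rcases Finset.mem_symmDiff.1 hj with h | h
        · exact hk' j h.1
        · exact hI j h.1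
      have h2 : matM c k * y.1 = matProd c (symmDiff {k} I) * d.1 := by
        rw [hy, ← Matrix.mul_assoc, ← matProd_singleton, matProd_mul_matProd c hk']
      exact ⟨⟨_, hJ, d, hd, by rw [Units.val_mul, hx, h2]⟩,
        ⟨_, hJ, d, hd, by rw [Units.val_mul, hinv, h2]⟩⟩
    · have hxD := hD x k hx hk
      have hcomm : Commute x.1 (matProd c I) := by
        rw [hx, ← matProd_singleton]
        exact matProd_commute c _ _
      refine ⟨⟨I, hI, x * d, D.mul_mem hxD hd, ?_⟩,
        ⟨I, hI, x⁻¹ * d, D.mul_mem (D.inv_mem hxD) hd, ?_⟩⟩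
      · rw [Units.val_mul, Units.val_mul, hy, ← Matrix.mul_assoc, hcomm.eq, Matrix.mul_assoc]
      · rw [Units.val_mul, Units.val_mul, hy, ← Matrix.mul_assoc, hcomm.units_inv_left.eq,
          Matrix.mul_assoc]
  induction ht using Subgroup.closure_induction_left with
  | one => exact ⟨∅, by simp, 1, D.one_mem, by simp [matProd_empty]⟩
  | mul_left x hx y _ ih => exact (step x hx.choose hx.choose_spec y ih).1
  | inv_mul_cancel x hx y _ ih => exact (step x hx.choose hx.choose_spec y ih).2

/-- The reflection subgroup is already generated by the conjugates of `M₀` under the commuting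
matrices `M_k`. -/
theorem Ref_le (a b : ℂ) (c : Fin n → ℂ) (K : Subgroup (GL (Idx n) ℂ))
    (hK : ∀ t ∈ torus c, ∀ r : GL (Idx n) ℂ, r.1 = matM₀ a b c → t * r * t⁻¹ ∈ K) :
    Ref a b c ≤ K := by
  let R' := Subgroup.closure {x | ∃ t ∈ torus c, ∃ r : GL (Idx n) ℂ, r.1 = matM₀ a b c ∧
    x = t * r * t⁻¹}
  have hr : ∀ r : GL (Idx n) ℂ, r.1 = matM₀ a b c → r ∈ R' := fun r hr =>
    Subgroup.subset_closure ⟨1, Subgroup.one_mem _, r, hr, by simp⟩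
  have hT : ∀ s ∈ torus c, ∀ x ∈ R', s * x * s⁻¹ ∈ R' := by
    intro s hs x hx
    have : R' ≤ R'.comap (MulAut.conj s).toMonoidHom := by
      refine (Subgroup.closure_le _).2 ?_
      rintro _ ⟨t, ht, r, hr, rfl⟩
      exact Subgroup.subset_closure ⟨s * t, Subgroup.mul_mem _ hs ht, r, hr, by
        simp [mul_assoc]⟩
    exact this hx
  have hM : ∀ g ∈ Mon a b c, (∀ x ∈ R', g * x * g⁻¹ ∈ R') ∧ ∀ x ∈ R', g⁻¹ * x * g ∈ R' := by
    intro g hg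
    induction hg using Subgroup.closure_induction with
    | mem g hg =>
      rcases hg with hg | hg
      · have h := hr g hg
        exact ⟨fun x hx => R'.mul_mem (R'.mul_mem h hx) (R'.inv_mem h),
          fun x hx => R'.mul_mem (R'.mul_mem (R'.inv_mem h) hx) h⟩
      · have h : g ∈ torus c := Subgroup.subset_closure hg
        exact ⟨hT g h, fun x hx => by simpa using hT g⁻¹ (Subgroup.inv_mem _ h) x hx⟩
    | one => simp
    | mul g h _ _ ihg ihh =>
      exact ⟨fun x hx => by simpa [mul_assoc] using ihg.1 _ (ihh.1 x hx),
        fun x hx => by simpa [mul_assoc] using ihh.2 _ (ihg.2 x hx)⟩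
    | inv g _ ih => exact ⟨by simpa using ih.2, by simpa using ih.1⟩
  refine (Subgroup.closure_le _).2 ?_
  rintro _ ⟨g, hg, r, hr', rfl⟩
  have hle : R' ≤ K := by
    refine (Subgroup.closure_le _).2 ?_
    rintro _ ⟨t, ht, r, hr, rfl⟩
    exact hK t ht r hr
  exact hle ((hM g hg).1 r (hr r hr'))

end Generators

/-! ### Exclusion of monomial monodromy groups -/

section Monomial

variable {n : ℕ}

theorem span_pair_le_stab {ι : Type*} [Fintype ι] [DecidableEq ι] {x y : ι → ℂ} {g : GL ι ℂ}
    (hx : g.1 *ᵥ x ∈ Submodule.span ℂ {x, y}) (hy : g.1 *ᵥ y ∈ Submodule.span ℂ {x, y}) :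
    g ∈ stab (Submodule.span ℂ {x, y}) := by
  intro z hz
  obtain ⟨p, q, rfl⟩ := Submodule.mem_span_pair.1 hz
  rw [mulVec_add, mulVec_smul, mulVec_smul]
  exact add_mem (Submodule.smul_mem _ _ hx) (Submodule.smul_mem _ _ hy)

/-- The space has dimension `2ⁿ ≥ 4`, so an irreducible group preserves no line and no plane. -/
theorem not_le_stab_span_pair (hn : 2 ≤ n) {G : Subgroup (GL (Idx n) ℂ)}
    (hirr : ActsIrreducibly G) {x y : Idx n → ℂ} (hx : x ≠ 0) :
    ¬ G ≤ stab (Submodule.span ℂ {x, y}) := by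
  intro h
  rcases (actsIrreducibly_iff G).1 hirr _ h with h0 | h0
  · exact hx ((Submodule.eq_bot_iff _).1 h0 x (Submodule.subset_span (by simp)))
  · have h1 : Module.finrank ℂ (Submodule.span ℂ {x, y}) ≤ 2 := by
      have := finrank_span_finset_le_card (R := ℂ) ({x, y} : Finset (Idx n → ℂ))
      rw [Finset.coe_pair] at this
      exact this.trans Finset.card_le_two
    rw [h0, finrank_top] at h1
    have h2 : Module.finrank ℂ (Idx n → ℂ) = 2 ^ n := by simp
    have h3 : 2 ^ 2 ≤ 2 ^ n := Nat.pow_le_pow_right (by norm_num) hn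
    omega

theorem conj_reflection_mulVec (a b : ℂ) (c : Fin n → ℂ) (t r : GL (Idx n) ℂ)
    (hr : r.1 = matM₀ a b c) (x : Idx n → ℂ) :
    (t * r * t⁻¹).1 *ᵥ x =
      x - (vecV a b c ⬝ᵥ ((t⁻¹).1 *ᵥ x)) • (t.1 *ᵥ Pi.single 1 1) := by
  rw [Units.val_mul, Units.val_mul, ← mulVec_mulVec, ← mulVec_mulVec, hr, matM₀_mulVec,
    mulVec_sub, mulVec_smul, mulVec_inv_mulVec]

/-- If all `γ_k` are `-1`, the span of the root of `M₀` and of its image under `M₁ ⋯ Mₙ` is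
invariant under the reflection subgroup. -/
theorem exists_gamma_ne_neg_one (hn : 2 ≤ n) {a b : ℂ} {c : Fin n → ℂ}
    (hirr : ActsIrreducibly (Ref a b c)) : ∃ k, expTwoPiI (c k) ≠ -1 := by
  by_contra! hγ
  let u : Idx n → ℂ := Pi.single 1 1
  have hu : u ≠ 0 := by simp [u]
  refine not_le_stab_span_pair hn hirr (x := u) (y := matProd c Finset.univ *ᵥ u) hu ?_
  refine Ref_le a b c _ fun t ht r hr => ?_
  obtain ⟨I, -, d, hd, hI⟩ := exists_matProd_of_mem_torus (D := ⊥)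
    (fun g k _ hk => absurd (hγ k) hk) ht
  rw [Subgroup.mem_bot.1 hd, Units.val_one, mul_one] at hI
  have hinv : (t⁻¹).1 = matProd c I := by
    have h1 := matProd_mul_self c (I := I) fun k _ => hγ k
    rw [← hI] at h1 ⊢
    exact Units.inv_eq_of_mul_eq_one_right h1
  have hmem : ∀ x y : Idx n → ℂ, x ∈ Submodule.span ℂ {x, y} ∧ y ∈ Submodule.span ℂ {x, y} :=
    fun x y => ⟨Submodule.subset_span (by simp), Submodule.subset_span (by simp)⟩
  have hu1 := hmem u (matProd c Finset.univ *ᵥ u)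
  by_cases hIt : I = ∅ ∨ I = Finset.univ
  · have htu : t.1 *ᵥ u ∈ Submodule.span ℂ {u, matProd c Finset.univ *ᵥ u} := by
      rcases hIt with rfl | rfl
      · rw [hI, matProd_empty, one_mulVec]
        exact hu1.1
      · rw [hI]
        exact hu1.2
    refine span_pair_le_stab ?_ ?_ <;> rw [conj_reflection_mulVec a b c t r hr] <;>
      refine sub_mem ?_ (Submodule.smul_mem _ _ htu)
    · exact hu1.1
    · exact hu1.2
  · rw [not_or] at hIt
    have hzero : ∀ J : Finset (Fin n), J ≠ ∅ → J ≠ Finset.univ →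
        vecV a b c ⬝ᵥ (matProd c J *ᵥ u) = 0 := by
      intro J hJ hJ'
      obtain ⟨k, hk⟩ := Finset.nonempty_iff_ne_empty.2 hJ
      obtain ⟨l, hl⟩ : ∃ l, l ∉ J := by
        by_contra! h
        exact hJ' (Finset.eq_univ_iff_forall.2 h)
      exact vecV_dotProduct_matProd a b c hk (hγ k) hl
    refine span_pair_le_stab ?_ ?_ <;> rw [conj_reflection_mulVec a b c t r hr, hinv]
    · rw [hzero I hIt.1 hIt.2, zero_smul, sub_zero]
      exact hu1.1
    · rw [mulVec_mulVec, matProd_mul_matProd c fun k _ => hγ k, hzero, zero_smul, sub_zero]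
      · exact hu1.2
      · intro h
        exact hIt.2 (symmDiff_eq_bot.1 h)
      · intro h
        refine hIt.1 (Finset.eq_empty_iff_forall_notMem.2 fun k hk => ?_)
        have : k ∈ symmDiff I Finset.univ := by rw [h]; exact Finset.mem_univ k
        simp [Finset.mem_symmDiff, hk] at this

/-- A monomial `M_k` with `γ_k ≠ -1` preserves every line: on a plane of two exchanged lines its
trace would be `0`, but also `1 + γ_k⁻¹`. -/
theorem mem_stab_line_of_ne_neg_one {κ : Type*} (f : Module.Basis κ ℂ (Idx n → ℂ))
    {c : Fin n → ℂ} {k : Fin n} (hγ : expTwoPiI (c k) ≠ -1) {g : GL (Idx n) ℂ}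
    (hg : g.1 = matM c k) (hmono : IsMonomial f g.1) (i : κ) :
    g ∈ stab (Submodule.span ℂ {f i}) := by
  have hγ0 := expTwoPiI_ne_zero (c k)
  obtain ⟨j, x, hx⟩ := hmono i
  obtain ⟨l, y, hy⟩ := hmono j
  intro z hz
  obtain ⟨p, rfl⟩ := Submodule.mem_span_singleton.1 hz
  rw [mulVec_smul, hx]
  by_cases hij : j = i
  · subst hij
    exact Submodule.smul_mem _ _ (Submodule.mem_span_singleton.2 ⟨x, rfl⟩)
  · exfalso
    have h1 := congrArg (fun A => A *ᵥ f i) (matM_mul_self c k)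
    simp only [← hg, ← mulVec_mulVec, hx, mulVec_smul, hy, sub_mulVec, smul_mulVec,
      one_mulVec] at h1
    have hi := congrArg (fun w => f.repr w i) h1
    have hj := congrArg (fun w => f.repr w j) h1
    have hli : l = i := by
      by_contra hli
      simp [hij, hli, hγ0] at hi
    subst hli
    have hx0 : x ≠ 0 := by
      rintro rfl
      exact mulVec_ne_zero g (f.ne_zero l) (by simpa using hx)
    simp [Ne.symm hij, hx0] at hj
    apply hγ
    field_simp at hj
    linear_combination hj

/-- The monodromy group does not permute the lines of a basis if the reflection subgroup is
irreducible. -/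
theorem not_monomial (hn : 2 ≤ n) {a b : ℂ} {c : Fin n → ℂ}
    (hirr : ActsIrreducibly (Ref a b c)) {κ : Type*} (f : Module.Basis κ ℂ (Idx n → ℂ))
    (hmono : ∀ g ∈ Mon a b c, IsMonomial f g.1) : False := by
  classical
  obtain ⟨k₀, hk₀⟩ := exists_gamma_ne_neg_one hn hirr
  have hmono' : ∀ g ∈ Mon a b c, ∀ i, ∃ j, ∃ x : ℂ, x ≠ 0 ∧ g.1 *ᵥ f i = x • f j := by
    intro g hg i
    obtain ⟨j, x, hx⟩ := hmono g hg i
    refine ⟨j, x, ?_, hx⟩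
    rintro rfl
    exact mulVec_ne_zero g (f.ne_zero i) (by simpa using hx)
  -- `D` is the group of elements that are diagonal in the basis `f`.
  let D : Subgroup (GL (Idx n) ℂ) := ⨅ i, stab (Submodule.span ℂ {f i})
  have hDmem : ∀ g ∈ D, ∀ i, ∃ x : ℂ, x ≠ 0 ∧ g.1 *ᵥ f i = x • f i := by
    intro g hg i
    obtain ⟨x, hx⟩ := Submodule.mem_span_singleton.1
      ((Subgroup.mem_iInf.1 hg i) (f i) (Submodule.mem_span_singleton_self _))
    refine ⟨x, ?_, hx.symm⟩
    rintro rfl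
    exact mulVec_ne_zero g (f.ne_zero i) (by simpa using hx.symm)
  have hD : ∀ (g : GL (Idx n) ℂ) (k : Fin n), g.1 = matM c k → expTwoPiI (c k) ≠ -1 → g ∈ D :=
    fun g k hg hk => Subgroup.mem_iInf.2 fun i =>
      mem_stab_line_of_ne_neg_one f hk hg (hmono g (Subgroup.subset_closure (Or.inr ⟨k, hg⟩))) i
  let v := vecV a b c
  let u : Idx n → ℂ := Pi.single 1 1
  have hr₀ : ∀ r : GL (Idx n) ℂ, r.1 = matM₀ a b c → ∀ x, r.1 *ᵥ x = x - (v ⬝ᵥ x) • u := by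
    intro r hr x
    rw [hr, matM₀_mulVec]
  -- `M₀` moves some line: otherwise the reflection subgroup would preserve every line.
  obtain ⟨r, hr, i₁, hi₁⟩ : ∃ r : GL (Idx n) ℂ, r.1 = matM₀ a b c ∧
      ∃ i, r.1 *ᵥ f i ∉ Submodule.span ℂ {f i} := by
    by_contra! h
    obtain ⟨i⟩ : Nonempty κ := f.index_nonempty
    refine not_le_stab_span_pair hn hirr (x := f i) (y := f i) (f.ne_zero i)
      (Ref_le a b c _ fun t ht r hr => ?_)
    have ht' := Subgroup.inv_mem _ (torus_le_Mon a b c ht)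
    obtain ⟨j, x, hx0, hx⟩ := hmono' _ ht' i
    obtain ⟨y, hy⟩ := Submodule.mem_span_singleton.1 (h r hr j)
    have hmem : (t * r * t⁻¹).1 *ᵥ f i ∈ Submodule.span ℂ {f i, f i} := by
      rw [Units.val_mul, Units.val_mul, ← mulVec_mulVec, ← mulVec_mulVec, hx, mulVec_smul, ← hy,
        smul_comm, ← hx, mulVec_smul, mulVec_inv_mulVec]
      exact Submodule.smul_mem _ _ (Submodule.subset_span (by simp))
    exact span_pair_le_stab hmem hmem
  have hrM : r ∈ Mon a b c := Subgroup.subset_closure (Or.inl hr)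
  obtain ⟨i₂, z, hz0, hz⟩ := hmono' r hrM i₁
  have hne : i₂ ≠ i₁ := by
    rintro rfl
    exact hi₁ (hz ▸ Submodule.smul_mem _ _ (Submodule.mem_span_singleton_self _))
  have hv₁ : v ⬝ᵥ f i₁ ≠ 0 := by
    intro h0
    apply hi₁
    rw [hr₀ r hr, h0, zero_smul, sub_zero]
    exact Submodule.mem_span_singleton_self _
  -- Hence the root `u` lies in the plane of the two exchanged lines, with nonzero coordinates.
  obtain ⟨x, y, hx0, hy0, hu⟩ : ∃ x y : ℂ, x ≠ 0 ∧ y ≠ 0 ∧ u = x • f i₁ + y • f i₂ := by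
    refine ⟨(v ⬝ᵥ f i₁)⁻¹, -(v ⬝ᵥ f i₁)⁻¹ * z, inv_ne_zero hv₁,
      mul_ne_zero (neg_ne_zero.2 (inv_ne_zero hv₁)) hz0, ?_⟩
    rw [mul_smul, ← hz, hr₀ r hr, smul_sub, smul_smul, neg_mul, inv_mul_cancel₀ hv₁, neg_smul,
      neg_smul, one_smul]
    abel
  -- The hyperplane fixed by `M₀` contains all other lines.
  have hv : ∀ j, j ≠ i₁ → j ≠ i₂ → v ⬝ᵥ f j = 0 := by
    intro j h1 h2
    by_contra h0
    obtain ⟨l, d, -, hd⟩ := hmono' r hrM j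
    rw [hr₀ r hr, hu] at hd
    have e1 := congrArg (fun w => f.repr w i₁) hd
    have e2 := congrArg (fun w => f.repr w j) hd
    have hl : l = i₁ := by
      by_contra hl
      simp [h1, hne, hl, h0, hx0] at e1
    subst hl
    simp [Ne.symm h1, Ne.symm h2] at e2
  have hP : ∀ x y : Idx n → ℂ, x ∈ Submodule.span ℂ {x, y} ∧ y ∈ Submodule.span ℂ {x, y} :=
    fun x y => ⟨Submodule.subset_span (by simp), Submodule.subset_span (by simp)⟩
  have hP₁ := (hP (f i₁) (f i₂)).1
  have hP₂ := (hP (f i₁) (f i₂)).2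
  refine not_le_stab_span_pair hn hirr (x := f i₁) (y := f i₂) (f.ne_zero i₁)
    (Ref_le a b c _ fun t ht r' hr' => ?_)
  -- It suffices that `t` maps the root into the plane, or that `t⁻¹` maps the plane into the
  -- hyperplane fixed by `M₀`.
  suffices h : t.1 *ᵥ u ∈ Submodule.span ℂ {f i₁, f i₂} ∨
      (v ⬝ᵥ ((t⁻¹).1 *ᵥ f i₁) = 0 ∧ v ⬝ᵥ ((t⁻¹).1 *ᵥ f i₂) = 0) by
    rcases h with h | h
    · refine span_pair_le_stab ?_ ?_ <;> rw [conj_reflection_mulVec a b c t r' hr'] <;>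
        refine sub_mem ?_ (Submodule.smul_mem _ _ h)
      · exact hP₁
      · exact hP₂
    · refine span_pair_le_stab ?_ ?_ <;> rw [conj_reflection_mulVec a b c t r' hr']
      · rw [h.1, zero_smul, sub_zero]
        exact hP₁
      · rw [h.2, zero_smul, sub_zero]
        exact hP₂
  have hs := Subgroup.inv_mem _ ht
  obtain ⟨I, hI, d, hd, hId⟩ := exists_matProd_of_mem_torus hD hs
  rcases I.eq_empty_or_nonempty with rfl | ⟨k, hk⟩
  · left
    rw [matProd_empty, Matrix.one_mul] at hId
    have htD : t ∈ D := by
      rw [← inv_inv t, Units.ext hId]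
      exact D.inv_mem hd
    obtain ⟨x', -, hx'⟩ := hDmem t htD i₁
    obtain ⟨y', -, hy'⟩ := hDmem t htD i₂
    rw [hu, mulVec_add, mulVec_smul, mulVec_smul, hx', hy']
    exact add_mem (Submodule.smul_mem _ _ (Submodule.smul_mem _ _ hP₁))
      (Submodule.smul_mem _ _ (Submodule.smul_mem _ _ hP₂))
  · obtain ⟨i, p, hp0, hp⟩ := hmono' _ (torus_le_Mon a b c hs) i₁
    obtain ⟨j, q, hq0, hq⟩ := hmono' _ (torus_le_Mon a b c hs) i₂
    obtain ⟨x', hx'0, hx'⟩ := hDmem d hd i₁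
    obtain ⟨y', hy'0, hy'⟩ := hDmem d hd i₂
    have hIi : matProd c I *ᵥ f i₁ = (x'⁻¹ * p) • f i := by
      rw [hId, ← mulVec_mulVec, hx', mulVec_smul] at hp
      rw [mul_smul, ← hp, smul_smul, inv_mul_cancel₀ hx'0, one_smul]
    have hIj : matProd c I *ᵥ f i₂ = (y'⁻¹ * q) • f j := by
      rw [hId, ← mulVec_mulVec, hy', mulVec_smul] at hq
      rw [mul_smul, ← hq, smul_smul, inv_mul_cancel₀ hy'0, one_smul]
    have htp : t.1 *ᵥ f i = p⁻¹ • f i₁ := by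
      have := congrArg (fun w => p⁻¹ • (t.1 *ᵥ w)) hp
      simp only [mulVec_inv_mulVec, mulVec_smul, smul_smul, inv_mul_cancel₀ hp0, one_smul] at this
      exact this.symm
    have htq : t.1 *ᵥ f j = q⁻¹ • f i₂ := by
      have := congrArg (fun w => q⁻¹ • (t.1 *ᵥ w)) hq
      simp only [mulVec_inv_mulVec, mulVec_smul, smul_smul, inv_mul_cancel₀ hq0, one_smul] at this
      exact this.symm
    have hij : i ≠ j := by
      rintro rfl
      have h1 := congrArg (fun w => f.repr w i₁) (htp.symm.trans htq)
      simp [hne, hp0] at h1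
    -- The image of the root under the product of the involutions has nonzero coordinates on the
    -- lines `i` and `j`, so `v` vanishes on both lines or on none.
    have hzero : (x * (x'⁻¹ * p)) * (v ⬝ᵥ f i) + (y * (y'⁻¹ * q)) * (v ⬝ᵥ f j) = 0 := by
      have h1 : v ⬝ᵥ (matProd c I *ᵥ u) = 0 :=
        vecV_dotProduct_matProd a b c hk (hI k hk) fun h => hk₀ (hI k₀ h)
      rw [hu, mulVec_add, mulVec_smul, mulVec_smul, hIi, hIj] at h1
      simpa [dotProduct_add, dotProduct_smul, mul_assoc] using h1
    have hcx : x * (x'⁻¹ * p) ≠ 0 := mul_ne_zero hx0 (mul_ne_zero (inv_ne_zero hx'0) hp0)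
    have hcy : y * (y'⁻¹ * q) ≠ 0 := mul_ne_zero hy0 (mul_ne_zero (inv_ne_zero hy'0) hq0)
    by_cases hi : v ⬝ᵥ f i = 0
    · have hj : v ⬝ᵥ f j = 0 := by
        rw [hi, mul_zero, zero_add] at hzero
        exact (mul_eq_zero.1 hzero).resolve_left hcy
      right
      rw [hp, hq, dotProduct_smul, dotProduct_smul, hi, hj]
      simp
    · have hj : v ⬝ᵥ f j ≠ 0 := by
        intro hj
        rw [hj, mul_zero, add_zero] at hzero
        exact hi ((mul_eq_zero.1 hzero).resolve_left hcx)
      have hi' : i = i₁ ∨ i = i₂ := by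
        by_contra! h
        exact hi (hv i h.1 h.2)
      have hj' : j = i₁ ∨ j = i₂ := by
        by_contra! h
        exact hj (hv j h.1 h.2)
      have hti : t.1 *ᵥ f i ∈ Submodule.span ℂ {f i₁, f i₂} := htp ▸ Submodule.smul_mem _ _ hP₁
      have htj : t.1 *ᵥ f j ∈ Submodule.span ℂ {f i₁, f i₂} := htq ▸ Submodule.smul_mem _ _ hP₂
      left
      rw [hu, mulVec_add, mulVec_smul, mulVec_smul]
      rcases hi' with rfl | rfl <;> rcases hj' with rfl | rfl
      · exact absurd rfl hij
      · exact add_mem (Submodule.smul_mem _ _ hti) (Submodule.smul_mem _ _ htj)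
      · exact add_mem (Submodule.smul_mem _ _ htj) (Submodule.smul_mem _ _ hti)
      · exact absurd rfl hij

end Monomial

/-! ### Finiteness -/

section Finiteness

theorem eq_smul_one_of_commute {ι : Type*} [Fintype ι] [DecidableEq ι] [Nonempty ι]
    {G : Subgroup (GL ι ℂ)} (hirr : ActsIrreducibly G) {A : Matrix ι ι ℂ}
    (hA : ∀ g ∈ G, A * g.1 = g.1 * A) : ∃ z : ℂ, A = z • 1 := by
  obtain ⟨z, hz⟩ := Module.End.exists_eigenvalue (toLin' A)
  have hmem : ∀ x, x ∈ Module.End.eigenspace (toLin' A) z ↔ A *ᵥ x = z • x := fun x => by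
    rw [Module.End.mem_eigenspace_iff, toLin'_apply]
  have htop := ((actsIrreducibly_iff G).1 hirr (Module.End.eigenspace (toLin' A) z) ?_).resolve_left
    hz
  · refine ⟨z, toLin'.injective (LinearMap.ext fun x => ?_)⟩
    rw [toLin'_apply, toLin'_apply, smul_mulVec, one_mulVec]
    exact (hmem x).1 (htop ▸ trivial)
  · intro g hg x hx
    rw [hmem] at hx ⊢
    rw [mulVec_mulVec, hA g hg, ← mulVec_mulVec, hx, mulVec_smul]

theorem finite_of_scalar {ι : Type*} [Fintype ι] [DecidableEq ι] [Nonempty ι]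
    {G : Subgroup (GL ι ℂ)} (hG : ∀ g ∈ G, ∃ z : ℂ, g.1 = z • 1) {q : ℕ} (hq : 0 < q)
    (hdet : ∀ g ∈ G, g.1.det ^ q = 1) : Finite G := by
  choose z hz using fun g : G => hG g.1 g.2
  have hpos : 0 < Fintype.card ι * q := Nat.mul_pos Fintype.card_pos hq
  have hroot : ∀ g : G, z g ∈ Polynomial.nthRootsFinset (Fintype.card ι * q) (1 : ℂ) := by
    intro g
    rw [Polynomial.mem_nthRootsFinset hpos, pow_mul, ← hdet g.1 g.2, hz g]
    simp
  refine Finite.of_injective (fun g : G => (⟨z g, hroot g⟩ : Polynomial.nthRootsFinset _ (1 : ℂ)))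
    fun g h hgh => ?_
  have h1 : z g = z h := congrArg Subtype.val hgh
  exact Subtype.ext (Units.ext (by rw [hz g, hz h, h1]))

/-- If a power of a matrix with eigenvalue `1` is scalar, it is the identity. -/
theorem det_pow_eq_one_of_fixed {ι : Type*} [Fintype ι] [DecidableEq ι] {g : GL ι ℂ}
    {x : ι → ℂ} (hx : x ≠ 0) (hgx : g.1 *ᵥ x = x) {m : ℕ} {z : ℂ} (hz : (g ^ m).1 = z • 1) :
    g.1.det ^ m = 1 := by
  have hfix : (g ^ m).1 *ᵥ x = x := by
    clear hz
    induction m with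
    | zero => simp
    | succ m ih => rw [pow_succ, Units.val_mul, ← mulVec_mulVec, hgx, ih]
  have hz1 : z = 1 := by
    rw [hz, smul_mulVec, one_mulVec] at hfix
    exact smul_left_injective ℂ hx (by simpa using hfix)
  rw [← det_pow, ← Units.val_pow_eq_pow_val, hz, hz1, one_smul, det_one]

theorem det_pow_eq_one_of_mem_closure {ι : Type*} [Fintype ι] [DecidableEq ι] {S : Set (GL ι ℂ)}
    {q : ℕ} (hS : ∀ g ∈ S, g.1.det ^ q = 1) {g : GL ι ℂ} (hg : g ∈ Subgroup.closure S) :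
    g.1.det ^ q = 1 := by
  have hle : Subgroup.closure S ≤ ((powMonoidHom q).comp GeneralLinearGroup.det).ker := by
    refine (Subgroup.closure_le _).2 fun g hg => Units.ext ?_
    simpa using hS g hg
  have := congrArg Units.val (hle hg)
  simpa using this

variable {n : ℕ} {a b : ℂ} {c : Fin n → ℂ}

theorem Ref_le_Mon : Ref a b c ≤ Mon a b c := by
  refine (Subgroup.closure_le _).2 ?_
  rintro _ ⟨g, hg, r, hr, rfl⟩
  exact Subgroup.mul_mem _ (Subgroup.mul_mem _ hg (Subgroup.subset_closure (Or.inl hr)))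
    (Subgroup.inv_mem _ hg)

theorem conj_mem_Ref {g : GL (Idx n) ℂ} (hg : g ∈ Mon a b c) :
    ∀ x ∈ Ref a b c, g * x * g⁻¹ ∈ Ref a b c := by
  have : Ref a b c ≤ (Ref a b c).comap (MulAut.conj g).toMonoidHom := by
    refine (Subgroup.closure_le _).2 ?_
    rintro _ ⟨h, hh, r, hr, rfl⟩
    exact Subgroup.subset_closure ⟨g * h, Subgroup.mul_mem _ hg hh, r, hr, by simp [mul_assoc]⟩
  exact fun x hx => this hx

theorem isReflection_conj (g r : GL (Idx n) ℂ) (hr : r.1 = matM₀ a b c) :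
    IsReflection (g * r * g⁻¹) := by
  refine ⟨vecV a b c ᵥ* (g⁻¹).1, g.1 *ᵥ Pi.single 1 1, fun x => ?_⟩
  rw [conj_reflection_mulVec a b c g r hr, dotProduct_mulVec]

theorem exists_fixed_of_eq_matM₀ (hn : 2 ≤ n) {r : GL (Idx n) ℂ} (hr : r.1 = matM₀ a b c) :
    ∃ x, x ≠ 0 ∧ r.1 *ᵥ x = x := by
  have h1 : 1 < Module.finrank ℂ (⊤ : Submodule ℂ (Idx n → ℂ)) := by
    rw [finrank_top]
    have : 1 < 2 ^ n := Nat.one_lt_two_pow (by omega)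
    simpa using this
  obtain ⟨x, -, hx0, hx⟩ := exists_ne_zero_dotProduct_eq_zero h1 (vecV a b c)
  exact ⟨x, hx0, by rw [hr, matM₀_mulVec, hx, zero_smul, sub_zero]⟩

theorem exists_eq_matM₀ (hn : 2 ≤ n) (a b : ℂ) (c : Fin n → ℂ) :
    ∃ r : GL (Idx n) ℂ, r.1 = matM₀ a b c := by
  have hdet : (matM₀ a b c).det ≠ 0 := by
    rw [det_matM₀ (by omega)]
    refine div_ne_zero (mul_ne_zero (by simp) ?_)
      (mul_ne_zero (expTwoPiI_ne_zero _) (expTwoPiI_ne_zero _))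
    exact Finset.prod_ne_zero_iff.2 fun k _ => expTwoPiI_ne_zero _
  exact ⟨GeneralLinearGroup.mkOfDetNeZero _ hdet, rfl⟩

theorem finite_Ref_of_scalar (hn : 2 ≤ n)
    (hH : ∀ h ∈ identityComponent (Ref a b c), ∃ z : ℂ, h.1 = z • 1) : Finite (Ref a b c) := by
  have hfi := finiteIndex_identityComponent (Ref a b c)
  obtain ⟨r, hr⟩ := exists_eq_matM₀ hn a b c
  have hrR : r ∈ Ref a b c := Subgroup.subset_closure ⟨1, Subgroup.one_mem _, r, hr, by simp⟩
  obtain ⟨m, hm, -, hmH⟩ := Subgroup.exists_pow_mem_of_index_ne_zero hfi.index_ne_zero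
    (⟨r, hrR⟩ : Ref a b c)
  obtain ⟨z, hz⟩ := hH (r ^ m) hmH
  obtain ⟨x, hx0, hx⟩ := exists_fixed_of_eq_matM₀ hn hr
  have hrdet := det_pow_eq_one_of_fixed hx0 hx hz
  have hdet : ∀ g ∈ Ref a b c, g.1.det ^ m = 1 := by
    intro g hg
    refine det_pow_eq_one_of_mem_closure ?_ hg
    rintro _ ⟨g, -, s, hs, rfl⟩
    rw [Units.val_mul, Units.val_mul, det_mul, det_mul, mul_right_comm, ← det_mul,
      ← Units.val_mul, mul_inv_cancel, hs, ← hr, Units.val_one, det_one, one_mul, hrdet]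
  have hfin := finite_of_scalar hH hm fun g hg => hdet g (identityComponent_le _ hg)
  have : Finite ((identityComponent (Ref a b c)).subgroupOf (Ref a b c)) :=
    Finite.of_injective (fun g => (⟨g.1.1, g.2⟩ : identityComponent (Ref a b c)))
      fun g h hgh => Subtype.ext (Subtype.ext (Subtype.mk.inj hgh))
  exact Finite.of_subgroup_quotient ((identityComponent (Ref a b c)).subgroupOf (Ref a b c))

/-- The monodromy group acts by conjugation on the finite irreducible group `Ref`, and the kernel
consists of scalars by Schur's lemma. Since each generator has eigenvalue `1`, its scalar powers are
trivial, so that the scalars in the monodromy group have determinants of bounded order. -/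
theorem finite_Mon_of_finite_Ref (hn : 2 ≤ n) (hirr : ActsIrreducibly (Ref a b c))
    (hfin : Finite (Ref a b c)) : Finite (Mon a b c) := by
  let N := (Ref a b c).subgroupOf (Mon a b c)
  have hN : N.Normal := ⟨fun x hx g => conj_mem_Ref g.2 x.1 hx⟩
  have hNfin : Finite N := Finite.of_injective (fun g => (⟨g.1.1, g.2⟩ : Ref a b c))
    fun g h hgh => Subtype.ext (Subtype.ext (Subtype.mk.inj hgh))
  have hAut : Finite (MulAut N) :=
    Finite.of_injective (fun e : MulAut N => (e : N → N)) DFunLike.coe_injective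
  let φ : Mon a b c →* MulAut N := MulAut.conjNormal
  have hker : ∀ g : Mon a b c, φ g = 1 → ∃ z : ℂ, g.1.1 = z • 1 := by
    intro g hg
    refine eq_smul_one_of_commute hirr fun x hx => ?_
    have h1 := congrArg (fun y : N => y.1.1)
      (DFunLike.congr_fun hg (⟨⟨x, Ref_le_Mon hx⟩, hx⟩ : N))
    have h2 : g.1 * x * g.1⁻¹ = x := h1
    rw [mul_inv_eq_iff_eq_mul] at h2
    exact congrArg Units.val h2
  have hpow : ∀ g : Mon a b c, φ (g ^ Nat.card (MulAut N)) = 1 := fun g => by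
    rw [map_pow, pow_card_eq_one']
  have hdet : ∀ g ∈ Mon a b c, g.1.det ^ Nat.card (MulAut N) = 1 := by
    intro g hg
    refine det_pow_eq_one_of_mem_closure (fun s hs => ?_) hg
    obtain ⟨x, hx0, hx⟩ : ∃ x, x ≠ 0 ∧ s.1 *ᵥ x = x := by
      rcases hs with hs | ⟨k, hk⟩
      · exact exists_fixed_of_eq_matM₀ hn hs
      · exact ⟨Pi.single 0 1, by simp, by rw [hk, matM_mulVec_single_zero]⟩
    obtain ⟨z, hz⟩ := hker _ (hpow ⟨s, Subgroup.subset_closure hs⟩)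
    exact det_pow_eq_one_of_fixed hx0 hx hz
  have hkfin : Finite (φ.ker.map (Mon a b c).subtype) := by
    refine finite_of_scalar ?_ (Nat.card_pos (α := MulAut N)) ?_
    · rintro _ ⟨g, hg, rfl⟩
      exact hker g hg
    · rintro _ ⟨g, -, rfl⟩
      exact hdet g.1 g.2
  have hkfin' : Finite φ.ker :=
    Finite.of_injective (fun g => (⟨g.1.1, g.1, g.2, rfl⟩ : φ.ker.map (Mon a b c).subtype))
      fun g h hgh => Subtype.ext (Subtype.ext (Subtype.mk.inj hgh))
  have hquot : Finite (Mon a b c ⧸ φ.ker) :=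
    Finite.of_equiv _ (QuotientGroup.quotientKerEquivRange φ).symm.toEquiv
  exact Finite.of_subgroup_quotient φ.ker

end Finiteness

end LauricellaFC

theorem theorem3 (n : ℕ) (hn : 2 ≤ n) (a b : ℂ) (c : Fin n → ℂ)
    (hirr : LauricellaFC.ActsIrreducibly (LauricellaFC.Ref a b c))
    (hred : ¬ LauricellaFC.ActsIrreducibly
      (LauricellaFC.identityComponent (LauricellaFC.Ref a b c))) :
    Finite (LauricellaFC.Ref a b c) ∧ Finite (LauricellaFC.Mon a b c) := by
  have hRef : Finite (LauricellaFC.Ref a b c) := by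
    rcases LauricellaFC.scalar_or_monomial (M := LauricellaFC.Mon a b c)
      (by rintro _ ⟨g, -, r, hr, rfl⟩; exact LauricellaFC.isReflection_conj g r hr)
      (fun r hr => LauricellaFC.Ref_le_Mon (Subgroup.subset_closure hr))
      (fun g hg h hh => LauricellaFC.conj_mem_identityComponent (LauricellaFC.conj_mem_Ref hg) hh)
      hirr hred with h | ⟨κ, f, hf⟩
    · exact LauricellaFC.finite_Ref_of_scalar hn h
    · exact (LauricellaFC.not_monomial hn hirr f hf).elim
  exact ⟨hRef, LauricellaFC.finite_Mon_of_finite_Ref hn hirr hRef⟩
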